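/- Let $\mathcal B$ be a complex Banach space and let $H$ be a closed densely defined operator on $\mathcal B$ with spectrum $\sigma(H)\subseteq[0,\infty)$. Write $\langle z\rangle:=(1+|z|^2)^{1/2}$, and suppose that for some constants $c$ and $\alpha\ge 0$ $$\|(z-H)^{-1}\|\le c\,|\operatorname{Im} z|^{-1}\left(\frac{\langle z\rangle}{|\operatorname{Im} z|}\right)^{\alpha}\qquad\text{for all } z\in\mathbb C\setminus\mathbb R .$$ For $\beta\in\mathbb R$ let $S^\beta$ be the set of smooth functions $f:\mathbb R\to\mathbb C$ such that for every integer $r\ge 0$ there is a constant $c_r>0$ with $|f^{(r)}(x)|\le c_r\langle x\rangle^{\beta-r}$ for all $x\in\mathbb R$, and let $\mathcal A:=\bigcup_{\beta<0}S^\beta$. Call a smooth function $\psi:\mathbb R\to\mathbb C$ a cut-off if $\psi(s)=1$ for $|s|\le 1$ and $\psi(s)=0$ for $|s|\ge 2$. For $f\in\mathcal A$, an integer $n>\alpha$ and a cut-off $\psi$ put $$\tilde f(x,y):=\left(\sum_{r=0}^{n} f^{(r)}(x)\frac{(iy)^r}{r!}\right)\psi\!\left(\frac{y}{\langle x\rangle}\right),\qquad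 \frac{\partial\tilde f}{\partial\bar z}:=\frac12\left(\frac{\partial\tilde f}{\partial x}+i\frac{\partial\tilde f}{\partial y}\right),$$ $$f(H):=-\frac1\pi\iint_{\mathbb C}\frac{\partial\tilde f}{\partial\bar z}\,(z-H)^{-1}\,dx\,dy ,\qquad z=x+iy .$$ If $f,g\in\mathcal A$ satisfy $f(x)=g(x)$ for all $x\in[0,\infty)$, then the integrals defining $f(H)$ and $g(H)$ converge absolutely in operator norm and $$f(H)=g(H),$$ where $f(H)$ and $g(H)$ may be formed with any integers $n,m>\alpha$ and any cut-offs $\psi,\chi$, respectively. In particular $f(H)$ depends only on the restriction of $f$ to $[0,\infty)$. -/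

import Mathlib

namespace HelfferSjostrand

noncomputable section

/-- The bracket `⟨z⟩ = (1 + |z|²)^{1/2}`; for real `x` it is used through the cast to `ℂ`. -/
def bracket (z : ℂ) : ℝ := Real.sqrt (1 + ‖z‖ ^ 2)

/-- The class `S^β`: smooth functions `f : ℝ → ℂ` such that for every `n` there is a positive
constant `c` with `|f⁽ⁿ⁾(x)| ≤ c ⟨x⟩^(β - n)` for all real `x`. -/
def symbolClass (β : ℝ) : Set (ℝ → ℂ) :=
  {f | ContDiff ℝ (⊤ : ℕ∞) f ∧
    ∀ n : ℕ, ∃ c : ℝ, 0 < c ∧ ∀ x : ℝ, ‖iteratedDeriv n f x‖ ≤ c * bracket (x : ℂ) ^ (β - n)}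

/-- The algebra `𝒜`, the union of the classes `S^β` over `β < 0`. -/
def slowAlgebra : Set (ℝ → ℂ) := {f | ∃ β : ℝ, β < 0 ∧ f ∈ symbolClass β}

/-- A cut-off profile: smooth, equal to `1` for `|s| ≤ 1` and to `0` for `|s| ≥ 2`
(so of compact support). -/
structure IsCutoff (ψ : ℝ → ℂ) : Prop where
  smooth : ContDiff ℝ (⊤ : ℕ∞) ψ
  eq_one : ∀ s : ℝ, |s| ≤ 1 → ψ s = 1
  eq_zero : ∀ s : ℝ, 2 ≤ |s| → ψ s = 0

/-- The almost analytic extension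
`f̃(x, y) = (∑_{r = 0}^n f⁽ʳ⁾(x) (iy)^r / r!) ψ(y / ⟨x⟩)`. -/
def almostAnalytic (n : ℕ) (ψ f : ℝ → ℂ) (x y : ℝ) : ℂ :=
  (∑ r ∈ Finset.range (n + 1),
      iteratedDeriv r f x * (Complex.I * (y : ℂ)) ^ r / (r.factorial : ℂ)) *
    ψ (y / bracket (x : ℂ))

/-- `∂F/∂z̄ = (∂F/∂x + i ∂F/∂y) / 2`. -/
def dbar (F : ℝ → ℝ → ℂ) (x y : ℝ) : ℂ :=
  (1 / 2 : ℂ) * (deriv (fun s => F s y) x + Complex.I * deriv (fun t => F x t) y)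

variable {B : Type*} [NormedAddCommGroup B] [NormedSpace ℂ B]

/-- `R` is a bounded, everywhere defined, two-sided inverse of `z - H : D(H) → B`. -/
def IsResolventAt (H : B →ₗ.[ℂ] B) (z : ℂ) (R : B →L[ℂ] B) : Prop :=
  (∀ v : B, ∃ h : R v ∈ H.domain, z • R v - H ⟨R v, h⟩ = v) ∧
    ∀ u : H.domain, R (z • (u : B) - H u) = u

theorem IsResolventAt.unique {H : B →ₗ.[ℂ] B} {z : ℂ} {R S : B →L[ℂ] B}
    (hR : IsResolventAt H z R) (hS : IsResolventAt H z S) : R = S := by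
  ext v
  obtain ⟨h, hv⟩ := hR.1 v
  have := hS.2 ⟨R v, h⟩
  rw [hv] at this
  exact this.symm

/-- The resolvent set of the (possibly unbounded) operator `H`. -/
def resolventSet (H : B →ₗ.[ℂ] B) : Set ℂ := {z | ∃ R : B →L[ℂ] B, IsResolventAt H z R}

/-- The spectrum `σ(H)`. -/
def spectrum (H : B →ₗ.[ℂ] B) : Set ℂ := (resolventSet H)ᶜ

open Classical in
/-- The resolvent `(z - H)⁻¹`, with the value `0` for `z` in the spectrum. -/
def resolvent (H : B →ₗ.[ℂ] B) (z : ℂ) : B →L[ℂ] B :=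
  if h : ∃ R : B →L[ℂ] B, IsResolventAt H z R then h.choose else 0

theorem isResolventAt_resolvent {H : B →ₗ.[ℂ] B} {z : ℂ} (hz : z ∈ resolventSet H) :
    IsResolventAt H z (resolvent H z) := by
  have h : ∃ R : B →L[ℂ] B, IsResolventAt H z R := hz
  rw [resolvent, dif_pos h]
  exact h.choose_spec

/-- The integrand `(∂f̃/∂z̄)(x, y) (z - H)⁻¹` at `z = x + iy`, with values in the bounded
operators on `B`. -/
def hsIntegrand (H : B →ₗ.[ℂ] B) (n : ℕ) (ψ f : ℝ → ℂ) (p : ℝ × ℝ) : B →L[ℂ] B :=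
  dbar (almostAnalytic n ψ f) p.1 p.2 • resolvent H ((p.1 : ℂ) + (p.2 : ℂ) * Complex.I)

/-- The operator `f(H) = -(1/π) ∬ (∂f̃/∂z̄) (z - H)⁻¹ dx dy`, formed with the order `n` and the
cut-off profile `ψ`; the integral is a Bochner integral for the operator norm. -/
def hsOperator (H : B →ₗ.[ℂ] B) (n : ℕ) (ψ f : ℝ → ℂ) : B →L[ℂ] B :=
  (-(1 / (Real.pi : ℂ))) • ∫ p : ℝ × ℝ, hsIntegrand H n ψ f p

end

end HelfferSjostrand

/-!
The difference `F` of the two almost analytic extensions satisfies `∬ (∂F/∂z̄) (z - H)⁻¹ = 0`.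
Over `x ≥ 0` the Taylor polynomials of `f` and `g` agree, so `F` vanishes there to order `p + 1` on
the real axis, with `p = min n m > α` (`exists_norm_almostAnalytic_sub_le`). Over `x < 0` there is
no such cancellation, but the resolvent is holomorphic across the axis.

Put `s = |y| / ⟨x⟩`. Everything lives in the cone `s ≤ 2`, where `∂f̃/∂z̄ = O(⟨x⟩^(β-1) s^n)` and
`(z - H)⁻¹ = O(⟨x⟩⁻¹ s^(-1-α))`; since `n > α` and `β < 0` the product is integrable
(`exists_dominating`).

To avoid a discussion at the end point `0`, the resolvent is first replaced by its translate
`Φ(z) = (z - δ - H)⁻¹`, holomorphic off `[δ, ∞)`. Then `F Φ` is continuous on the whole plane, the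
order of vanishing of `F` beating the singularity of `Φ` on `[δ, ∞)` (`continuous_smul_of_growth`).
Stokes' theorem on the two halves of a rectangle symmetric about the real axis therefore has no
contribution from the axis (`setIntegral_rect_eq`). The horizontal sides lie outside the support,
and on the vertical sides `F Φ = O(⟨x⟩^(β-1))`, so that they contribute `O(⟨x⟩^β)` and vanish in the
limit (`integral_dbar_smul_eq_zero`). On the left vertical side this needs `Φ = O(⟨x⟩⁻¹)` up to the
real axis, which follows from the growth bound off the axis by the maximum principle
(`ResolventGrowth.exists_norm_le_left`). Finally `δ → 0` by dominated convergence.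
-/

namespace HelfferSjostrand

open Filter Topology MeasureTheory Set

/-! ### The bracket -/

theorem one_le_bracket (z : ℂ) : 1 ≤ bracket z := by
  unfold bracket
  rw [Real.one_le_sqrt]
  nlinarith [norm_nonneg z]

theorem bracket_pos (z : ℂ) : 0 < bracket z := one_pos.trans_le (one_le_bracket z)

theorem bracket_sq (z : ℂ) : bracket z ^ 2 = 1 + ‖z‖ ^ 2 := by
  unfold bracket
  rw [Real.sq_sqrt (by positivity)]

theorem bracket_ofReal (x : ℝ) : bracket (x : ℂ) = Real.sqrt (1 + x ^ 2) := by
  simp [bracket]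

theorem bracket_ofReal_sq (x : ℝ) : bracket (x : ℂ) ^ 2 = 1 + x ^ 2 := by
  simp [bracket_sq]

theorem abs_le_bracket (x : ℝ) : |x| ≤ bracket (x : ℂ) :=
  abs_le_of_sq_le_sq (by rw [bracket_ofReal_sq]; linarith) (bracket_pos _).le

theorem contDiff_bracket : ContDiff ℝ (⊤ : ℕ∞) (fun x : ℝ => bracket (x : ℂ)) := by
  simp only [bracket_ofReal]
  exact ContDiff.sqrt (by fun_prop) fun x => by positivity

theorem hasDerivAt_bracket (x : ℝ) :
    HasDerivAt (fun x : ℝ => bracket (x : ℂ)) (x / bracket (x : ℂ)) x := by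
  have h : HasDerivAt (fun x : ℝ => 1 + x ^ 2) (2 * x) x := by
    simpa using (hasDerivAt_pow 2 x).const_add 1
  have h' := h.sqrt (by positivity)
  simp only [bracket_ofReal]
  convert h' using 1
  field_simp

theorem bracket_le_bracket {x u : ℝ} (h : |x| ≤ |u|) : bracket (x : ℂ) ≤ bracket (u : ℂ) := by
  rw [bracket_ofReal, bracket_ofReal]
  exact Real.sqrt_le_sqrt (by linarith [sq_le_sq.2 h])

theorem bracket_le_three_mul {x y : ℝ} (h : |y| ≤ 2 * bracket (x : ℂ)) :
    bracket ((x : ℂ) + (y : ℂ) * Complex.I) ≤ 3 * bracket (x : ℂ) := by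
  have hb := bracket_pos (x : ℂ)
  refine le_of_sq_le_sq ?_ (by positivity)
  have h1 : y ^ 2 ≤ (2 * bracket (x : ℂ)) ^ 2 := sq_le_sq' (by linarith [neg_abs_le y])
    (by linarith [le_abs_self y])
  have h2 : ‖(x : ℂ) + (y : ℂ) * Complex.I‖ ^ 2 = x ^ 2 + y ^ 2 := by
    rw [Complex.sq_norm, Complex.normSq_add_mul_I]
  rw [bracket_sq, h2]
  nlinarith [bracket_ofReal_sq x]

theorem bracket_sub_le_two_mul (z : ℂ) {δ : ℝ} (h0 : 0 ≤ δ) (h1 : δ ≤ 1) :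
    bracket (z - δ) ≤ 2 * bracket z := by
  refine le_of_sq_le_sq ?_ (by linarith [bracket_pos z])
  have h2 : ‖z - δ‖ ≤ ‖z‖ + 1 := (norm_sub_le _ _).trans (by
    rw [Complex.norm_real, Real.norm_of_nonneg h0]; linarith)
  rw [mul_pow, bracket_sq, bracket_sq]
  nlinarith [norm_nonneg (z - δ), norm_nonneg z, sq_nonneg (‖z‖ - 1)]

/-! ### The resolvent -/

section Resolvent

variable {B : Type*} [NormedAddCommGroup B] [NormedSpace ℂ B]

/-- The first resolvent identity. -/
theorem resolvent_sub_resolvent {H : B →ₗ.[ℂ] B} {z w : ℂ} (hz : z ∈ resolventSet H)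
    (hw : w ∈ resolventSet H) :
    resolvent H w - resolvent H z = (z - w) • (resolvent H w * resolvent H z) := by
  ext v
  obtain ⟨h, hv⟩ := (isResolventAt_resolvent hz).1 v
  have h2 := (isResolventAt_resolvent hw).2 ⟨resolvent H z v, h⟩
  have h3 : w • resolvent H z v - H ⟨resolvent H z v, h⟩ = v - (z - w) • resolvent H z v := by
    rw [eq_sub_iff_add_eq]
    refine Eq.trans ?_ hv
    module
  simp only at h2
  rw [h3, map_sub, map_smul] at h2
  simp only [sub_apply, smul_apply, mul_apply_eq_comp]
  rw [sub_eq_iff_eq_add, ← sub_eq_iff_eq_add', h2]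

/-- The resolvent is holomorphic on the interior of the resolvent set: near `z` the first resolvent
identity expresses it through the inverse of `1 - (z - w) R(z)`. -/
theorem differentiableAt_resolvent [CompleteSpace B] {H : B →ₗ.[ℂ] B} {z : ℂ}
    (hz : resolventSet H ∈ 𝓝 z) : DifferentiableAt ℂ (resolvent H) z := by
  have hz' := mem_of_mem_nhds hz
  set R := resolvent H z with hR
  let A : ℂ → (B →L[ℂ] B) := fun w => 1 - (z - w) • R
  have hA : DifferentiableAt ℂ A z := by fun_prop
  have hAz : A z = 1 := by simp [A]
  have hunit : IsUnit (A z) := by rw [hAz]; exact isUnit_one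
  have hev : ∀ᶠ w in 𝓝 z, IsUnit (A w) :=
    hA.continuousAt.eventually (Units.isOpen.mem_nhds hunit)
  have hd : DifferentiableAt ℂ (fun w => R * Ring.inverse (A w)) z :=
    ((differentiableAt_inverse hunit).comp z hA).const_mul R
  refine hd.congr_of_eventuallyEq ?_
  filter_upwards [hev, hz] with w hw hwr
  have h1 := resolvent_sub_resolvent hz' hwr
  have h2 : resolvent H w * A w = R := by
    simp only [A, mul_sub, mul_one, mul_smul_comm]
    rw [← hR] at h1
    rw [← h1]
    abel
  rw [← h2, mul_assoc, Ring.mul_inverse_cancel _ hw, mul_one]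

end Resolvent

/-! ### Growth near the real axis -/

section Growth

variable {E : Type*} [NormedAddCommGroup E]

/-- The growth condition `‖Φ(z)‖ ≤ c |Im z|⁻¹ (⟨z⟩ / |Im z|)^α` off the real axis. -/
def ResolventGrowth (α c : ℝ) (Φ : ℂ → E) : Prop :=
  ∀ z : ℂ, z.im ≠ 0 → ‖Φ z‖ ≤ c * |z.im|⁻¹ * (bracket z / |z.im|) ^ α

theorem ResolventGrowth.nonneg {α c : ℝ} {Φ : ℂ → E} (h : ResolventGrowth α c Φ) : 0 ≤ c := by
  have h1 := (norm_nonneg _).trans (h Complex.I (by simp))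
  have h2 : 0 < (bracket Complex.I / |Complex.I.im|) ^ α :=
    Real.rpow_pos_of_pos (by simpa using bracket_pos _) _
  simp only [Complex.I_im, abs_one, inv_one, mul_one] at h1 h2
  exact nonneg_of_mul_nonneg_left h1 h2

theorem ResolventGrowth.comp_sub {α c δ : ℝ} {Φ : ℂ → E} (hα : 0 ≤ α)
    (h : ResolventGrowth α c Φ) (h0 : 0 ≤ δ) (h1 : δ ≤ 1) :
    ResolventGrowth α (c * 2 ^ α) (fun z => Φ (z - δ)) := by
  intro z hz
  have him : (z - δ).im = z.im := by simp
  have hc := h.nonneg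
  have hy : 0 < |z.im| := abs_pos.2 hz
  refine (h _ (by rwa [him])).trans ?_
  rw [him, mul_assoc c (2 ^ α), mul_comm (2 ^ α), ← mul_assoc, mul_assoc (c * _),
    ← Real.mul_rpow (by norm_num) (div_nonneg (bracket_pos z).le hy.le), ← mul_div_assoc]
  have := bracket_sub_le_two_mul z h0 h1
  have := bracket_pos (z - δ)
  gcongr

/-- In the cone `|y| ≤ 2⟨x⟩` the growth bound only involves `⟨x⟩` and the ratio `|y| / ⟨x⟩`. -/
theorem ResolventGrowth.norm_le {α c : ℝ} {Φ : ℂ → E} (hα : 0 ≤ α)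
    (h : ResolventGrowth α c Φ) {x y : ℝ} (hy : y ≠ 0) (hxy : |y| ≤ 2 * bracket (x : ℂ)) :
    ‖Φ (x + y * Complex.I)‖ ≤
      c * 3 ^ α * (bracket (x : ℂ))⁻¹ * (|y| / bracket (x : ℂ)) ^ (-1 - α) := by
  have hb := bracket_pos (x : ℂ)
  have hy' : 0 < |y| := abs_pos.2 hy
  have hc := h.nonneg
  have him : ((x : ℂ) + y * Complex.I).im = y := by simp
  have h1 := h ((x : ℂ) + y * Complex.I) (by rwa [him])
  rw [him] at h1
  refine h1.trans ?_
  have h2 : (bracket ((x : ℂ) + y * Complex.I) / |y|) ^ α ≤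
      3 ^ α * (|y| / bracket (x : ℂ)) ^ (-α) := by
    rw [Real.rpow_neg (by positivity), ← Real.inv_rpow (by positivity), inv_div,
      ← Real.mul_rpow (by norm_num) (by positivity), ← mul_div_assoc]
    have := bracket_le_three_mul hxy
    have := bracket_pos ((x : ℂ) + y * Complex.I)
    gcongr
  have h3 : (bracket (x : ℂ))⁻¹ * (|y| / bracket (x : ℂ)) ^ (-1 - α) =
      |y|⁻¹ * (|y| / bracket (x : ℂ)) ^ (-α) := by
    rw [sub_eq_add_neg, Real.rpow_add (by positivity), Real.rpow_neg_one]
    field_simp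
  rw [mul_assoc (c * 3 ^ α), h3]
  calc _ ≤ c * |y|⁻¹ * (3 ^ α * (|y| / bracket (x : ℂ)) ^ (-α)) := by gcongr
    _ = _ := by ring

variable [NormedSpace ℂ E]

/-- On the left half plane, where `Φ` is holomorphic across the real axis, the singular growth
bound improves to `O(⟨x⟩⁻¹)`: multiply `Φ` by a power of `(z - x)² - ρ²`, which vanishes where the
circle of radius `ρ = |x| / 2` about `x` meets the real axis, and use the maximum principle. -/
theorem ResolventGrowth.exists_norm_le_left {α c : ℝ} {Φ : ℂ → E} (hα : 0 ≤ α)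
    (h : ResolventGrowth α c Φ) (hd : ∀ z : ℂ, z.re < 0 → DifferentiableAt ℂ Φ z) :
    ∃ K : ℝ, ∀ x y : ℝ, x ≤ -1 → |y| ≤ 2 * bracket (x : ℂ) →
      ‖Φ (x + y * Complex.I)‖ ≤ K * (bracket (x : ℂ))⁻¹ := by
  have hc := h.nonneg
  obtain ⟨k, hk⟩ := exists_nat_ge (1 + α)
  have hk1 : k ≠ 0 := by
    rintro rfl
    norm_num at hk
    linarith
  refine ⟨max (c * 3 ^ α * (1 / 8) ^ (-1 - α)) (4 * (c * 4 ^ α * 2 ^ k)), fun x y hx hy => ?_⟩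
  have hb := bracket_pos (x : ℂ)
  have hb2 : bracket (x : ℂ) ≤ 2 * |x| := by
    refine le_of_sq_le_sq ?_ (by positivity)
    rw [bracket_ofReal_sq, mul_pow, sq_abs]
    nlinarith
  have hxa : |x| = -x := abs_of_neg (by linarith)
  rcases le_or_gt (|x| / 4) |y| with hcase | hcase
  ·
    -- far from the axis the ratio `|y| / ⟨x⟩` is at least `1 / 8`
    have hy0 : y ≠ 0 := by
      rintro rfl
      rw [abs_zero] at hcase
      linarith
    have hs : (1 / 8 : ℝ) ≤ |y| / bracket (x : ℂ) := by
      rw [le_div_iff₀ hb]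
      linarith
    have h2 : (|y| / bracket (x : ℂ)) ^ (-1 - α) ≤ (1 / 8 : ℝ) ^ (-1 - α) :=
      Real.rpow_le_rpow_of_nonpos (by norm_num) hs (by linarith)
    calc _ ≤ c * 3 ^ α * (bracket (x : ℂ))⁻¹ * (|y| / bracket (x : ℂ)) ^ (-1 - α) :=
          h.norm_le hα hy0 hy
      _ ≤ c * 3 ^ α * (bracket (x : ℂ))⁻¹ * (1 / 8 : ℝ) ^ (-1 - α) := by gcongr
      _ = c * 3 ^ α * (1 / 8) ^ (-1 - α) * (bracket (x : ℂ))⁻¹ := by ring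
      _ ≤ _ := by gcongr; exact le_max_left _ _
  · set ρ : ℝ := |x| / 2 with hρ
    have hρ1 : 1 / 2 ≤ ρ := by linarith
    have hρ0 : 0 < ρ := by linarith
    set P : ℂ → ℂ := fun z => ((z - x) ^ 2 - (ρ : ℂ) ^ 2) ^ k with hP
    have hre : ∀ z ∈ Metric.closedBall (x : ℂ) ρ, z.re < 0 := fun z hz => by
      have h1 := (Complex.abs_re_le_norm (z - x)).trans (mem_closedBall_iff_norm.1 hz)
      rw [Complex.sub_re, Complex.ofReal_re] at h1
      linarith [le_abs_self (z.re - x)]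
    have hdiff : DifferentiableOn ℂ (fun z => P z • Φ z) (Metric.closedBall (x : ℂ) ρ) :=
      fun z hz => (DifferentiableAt.smul (by fun_prop) (hd z (hre z hz))).differentiableWithinAt
    have hcl : DiffContOnCl ℂ (fun z => P z • Φ z) (Metric.ball (x : ℂ) ρ) :=
      DifferentiableOn.diffContOnCl (by rwa [closure_ball _ hρ0.ne'])
    have hfr : ∀ z ∈ frontier (Metric.ball (x : ℂ) ρ),
        ‖P z • Φ z‖ ≤ c * 4 ^ α * 2 ^ k * ρ⁻¹ * (ρ ^ 2) ^ k := by
      intro z hz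
      rw [frontier_ball _ hρ0.ne', mem_sphere_iff_norm] at hz
      have hz2 : (z.re - x) ^ 2 + z.im ^ 2 = ρ ^ 2 := by
        rw [← hz, Complex.sq_norm, Complex.normSq_apply]
        simp
        ring
      -- on the circle, `(z - x)² - ρ²` has modulus `2ρ |Im z|`
      have hfac : (z - x) ^ 2 - (ρ : ℂ) ^ 2 = (2 * z.im : ℝ) * Complex.I * (z - x) := by
        apply Complex.ext
        · simp [pow_two]
          linear_combination hz2
        · simp [pow_two]
          ring
      have hPz : ‖P z‖ = (2 * |z.im| * ρ) ^ k := by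
        simp only [hP]
        rw [norm_pow, hfac, norm_mul, norm_mul, hz, Complex.norm_I, Complex.norm_real,
          Real.norm_eq_abs, abs_mul, abs_two, mul_one]
      rw [norm_smul, hPz]
      rcases eq_or_ne z.im 0 with h0 | h0
      · simp only [h0, abs_zero, mul_zero, zero_mul, zero_pow hk1]
        positivity
      have hv : 0 < |z.im| := abs_pos.2 h0
      have hvρ : |z.im| ≤ ρ := by
        refine abs_le_of_sq_le_sq ?_ hρ0.le
        nlinarith [sq_nonneg (z.re - x)]
      have hbz : bracket z ≤ 4 * ρ := by
        refine le_of_sq_le_sq ?_ (by positivity)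
        have h3 : ‖z‖ ≤ 3 * ρ := by
          have := norm_add_le (z - x) (x : ℂ)
          rw [sub_add_cancel, hz, Complex.norm_real, Real.norm_eq_abs] at this
          linarith
        rw [bracket_sq]
        nlinarith [norm_nonneg z]
      have hbz0 := bracket_pos z
      have h4 : ‖Φ z‖ ≤ c * 4 ^ α * ρ⁻¹ * (ρ / |z.im|) ^ k := by
        calc ‖Φ z‖ ≤ c * |z.im|⁻¹ * (bracket z / |z.im|) ^ α := h z h0
          _ ≤ c * |z.im|⁻¹ * (4 * ρ / |z.im|) ^ α := by gcongr
          _ = c * 4 ^ α * ρ⁻¹ * (ρ / |z.im|) ^ (1 + α) := by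
              rw [Real.rpow_add (by positivity), Real.rpow_one, mul_div_assoc,
                Real.mul_rpow (by norm_num) (by positivity)]
              field_simp
          _ ≤ c * 4 ^ α * ρ⁻¹ * (ρ / |z.im|) ^ (k : ℝ) := by
              gcongr
              rwa [one_le_div hv]
          _ = _ := by rw [Real.rpow_natCast]
      calc (2 * |z.im| * ρ) ^ k * ‖Φ z‖
          ≤ (2 * |z.im| * ρ) ^ k * (c * 4 ^ α * ρ⁻¹ * (ρ / |z.im|) ^ k) := by gcongr
        _ = c * 4 ^ α * ρ⁻¹ * ((2 * |z.im| * ρ) * (ρ / |z.im|)) ^ k := by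
            rw [mul_pow (2 * |z.im| * ρ)]
            ring
        _ = c * 4 ^ α * ρ⁻¹ * (2 * ρ ^ 2) ^ k := by congr 2; field_simp
        _ = _ := by rw [mul_pow]; ring
    have hmem : (x : ℂ) + y * Complex.I ∈ closure (Metric.ball (x : ℂ) ρ) := by
      rw [closure_ball _ hρ0.ne', mem_closedBall_iff_norm]
      simp
      linarith
    have hmax := Complex.norm_le_of_forall_mem_frontier_norm_le Metric.isBounded_ball hcl hfr hmem
    have hPw : (ρ ^ 2) ^ k ≤ ‖P (x + y * Complex.I)‖ := by
      simp only [hP]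
      rw [norm_pow]
      refine pow_le_pow_left₀ (by positivity) ?_ k
      have : ((x : ℂ) + y * Complex.I - x) ^ 2 - (ρ : ℂ) ^ 2 = ((-(y ^ 2 + ρ ^ 2) : ℝ) : ℂ) := by
        push_cast
        linear_combination (y : ℂ) ^ 2 * Complex.I_sq
      rw [this, Complex.norm_real, norm_neg, Real.norm_of_nonneg (by positivity)]
      nlinarith
    rw [norm_smul] at hmax
    have h5 : (ρ ^ 2) ^ k * ‖Φ (x + y * Complex.I)‖ ≤
        (ρ ^ 2) ^ k * (c * 4 ^ α * 2 ^ k * ρ⁻¹) := by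
      calc _ ≤ ‖P (x + y * Complex.I)‖ * ‖Φ (x + y * Complex.I)‖ := by gcongr
        _ ≤ _ := hmax
        _ = _ := by ring
    have h6 : ‖Φ (x + y * Complex.I)‖ ≤ c * 4 ^ α * 2 ^ k * ρ⁻¹ :=
      le_of_mul_le_mul_left h5 (by positivity)
    have h7 : ρ⁻¹ ≤ 4 * (bracket (x : ℂ))⁻¹ := by
      rw [← div_eq_mul_inv, inv_eq_one_div, div_le_div_iff₀ hρ0 hb]
      linarith
    calc _ ≤ c * 4 ^ α * 2 ^ k * (4 * (bracket (x : ℂ))⁻¹) := h6.trans (by gcongr)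
      _ = 4 * (c * 4 ^ α * 2 ^ k) * (bracket (x : ℂ))⁻¹ := by ring
      _ ≤ _ := by gcongr; exact le_max_right _ _

end Growth

/-! ### Almost analytic extensions -/

/-- The formal Taylor polynomial `∑_{r ≤ n} f⁽ʳ⁾(x) (iy)^r / r!` of `f` at `x`, evaluated at the
complex increment `iy`. -/
noncomputable def taylorSum (n : ℕ) (f : ℝ → ℂ) (x y : ℝ) : ℂ :=
  ∑ r ∈ Finset.range (n + 1), iteratedDeriv r f x * (Complex.I * (y : ℂ)) ^ r / (r.factorial : ℂ)

theorem almostAnalytic_eq (n : ℕ) (ψ f : ℝ → ℂ) (x y : ℝ) :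
    almostAnalytic n ψ f x y = taylorSum n f x y * ψ (y / bracket (x : ℂ)) := rfl

theorem contDiff_iteratedDeriv {f : ℝ → ℂ} (hf : ContDiff ℝ (⊤ : ℕ∞) f) (r : ℕ) :
    ContDiff ℝ (⊤ : ℕ∞) (iteratedDeriv r f) := by
  rw [iteratedDeriv_eq_iterate]
  exact hf.iterate_deriv r

theorem hasDerivAt_iteratedDeriv {f : ℝ → ℂ} (hf : ContDiff ℝ (⊤ : ℕ∞) f) (r : ℕ) (x : ℝ) :
    HasDerivAt (iteratedDeriv r f) (iteratedDeriv (r + 1) f x) x := by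
  rw [iteratedDeriv_succ]
  exact ((contDiff_iteratedDeriv hf r).differentiable (by simp) x).hasDerivAt

theorem contDiff_almostAnalytic {f ψ : ℝ → ℂ} (hf : ContDiff ℝ (⊤ : ℕ∞) f)
    (hψ : ContDiff ℝ (⊤ : ℕ∞) ψ) (n : ℕ) :
    ContDiff ℝ (⊤ : ℕ∞) (fun p : ℝ × ℝ => almostAnalytic n ψ f p.1 p.2) := by
  unfold almostAnalytic
  have hy : ContDiff ℝ (⊤ : ℕ∞) (fun p : ℝ × ℝ => (p.2 : ℂ)) :=
    Complex.ofRealCLM.contDiff.comp contDiff_snd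
  refine ContDiff.mul (ContDiff.sum fun r _ => ?_) (hψ.comp ?_)
  · exact (((contDiff_iteratedDeriv hf r).comp contDiff_fst).mul
      ((contDiff_const.mul hy).pow r)).div_const _
  · exact contDiff_snd.div (contDiff_bracket.comp contDiff_fst) fun p => (bracket_pos _).ne'

theorem hasDerivAt_taylorSum_fst {f : ℝ → ℂ} (hf : ContDiff ℝ (⊤ : ℕ∞) f) (n : ℕ) (x y : ℝ) :
    HasDerivAt (fun s => taylorSum n f s y)
      (∑ r ∈ Finset.range (n + 1),
        iteratedDeriv (r + 1) f x * (Complex.I * (y : ℂ)) ^ r / (r.factorial : ℂ)) x :=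
  HasDerivAt.fun_sum fun r _ => ((hasDerivAt_iteratedDeriv hf r x).mul_const _).div_const _

theorem hasDerivAt_taylorSum_snd (f : ℝ → ℂ) (n : ℕ) (x y : ℝ) :
    HasDerivAt (fun t => taylorSum n f x t)
      (Complex.I * ∑ r ∈ Finset.range n,
        iteratedDeriv (r + 1) f x * (Complex.I * (y : ℂ)) ^ r / (r.factorial : ℂ)) y := by
  induction n with
  | zero => simpa [taylorSum] using hasDerivAt_const y (f x)
  | succ n ih =>
    simp only [taylorSum] at ih ⊢
    simp only [Finset.sum_range_succ _ (n + 1)]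
    rw [Finset.sum_range_succ, mul_add]
    refine ih.add ?_
    have h1 : HasDerivAt (fun t : ℝ => Complex.I * (t : ℂ)) Complex.I y := by
      simpa using (Complex.ofRealCLM.hasDerivAt (x := y)).const_mul Complex.I
    have h2 := ((h1.pow (n + 1)).const_mul (iteratedDeriv (n + 1) f x)).div_const
      ((n + 1).factorial : ℂ)
    refine h2.congr_deriv ?_
    rw [Nat.factorial_succ]
    push_cast
    have h3 : (n : ℂ) + 1 ≠ 0 := by exact_mod_cast n.succ_ne_zero
    have h4 : (n.factorial : ℂ) ≠ 0 := by exact_mod_cast n.factorial_ne_zero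
    field_simp

/-- `∂/∂z̄` of an almost analytic extension. In `∂_x + i ∂_y` applied to the Taylor polynomial all
terms cancel except the one of top order. -/
theorem dbar_almostAnalytic {f ψ : ℝ → ℂ} (hf : ContDiff ℝ (⊤ : ℕ∞) f)
    (hψ : ContDiff ℝ (⊤ : ℕ∞) ψ) (n : ℕ) (x y : ℝ) :
    dbar (almostAnalytic n ψ f) x y = (1 / 2 : ℂ) *
      (iteratedDeriv (n + 1) f x * (Complex.I * (y : ℂ)) ^ n / (n.factorial : ℂ) *
          ψ (y / bracket (x : ℂ)) +
        taylorSum n f x y * deriv ψ (y / bracket (x : ℂ)) * (((bracket (x : ℂ))⁻¹ : ℝ) : ℂ) *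
          (Complex.I - ((y / bracket (x : ℂ) * (x / bracket (x : ℂ)) : ℝ) : ℂ))) := by
  have hb := (bracket_pos (x : ℂ)).ne'
  have hψ' : HasDerivAt ψ (deriv ψ (y / bracket (x : ℂ))) (y / bracket (x : ℂ)) :=
    (hψ.differentiable (by simp) _).hasDerivAt
  have hσx := hψ'.scomp x ((hasDerivAt_const x y).div (hasDerivAt_bracket x) hb)
  have hσy := hψ'.scomp y ((hasDerivAt_id y).div_const (bracket (x : ℂ)))
  have hx := (hasDerivAt_taylorSum_fst hf n x y).mul hσx
  have hy := (hasDerivAt_taylorSum_snd f n x y).mul hσy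
  have e1 : deriv (fun s => almostAnalytic n ψ f s y) x = _ := hx.deriv
  have e2 : deriv (fun t => almostAnalytic n ψ f x t) y = _ := hy.deriv
  rw [dbar, e1, e2, Finset.sum_range_succ]
  simp only [Function.comp_apply, Complex.real_smul, id, Pi.div_apply]
  generalize ∑ r ∈ Finset.range n,
    iteratedDeriv (r + 1) f x * (Complex.I * (y : ℂ)) ^ r / (r.factorial : ℂ) = S
  push_cast
  linear_combination (1 / 2 * ψ (y / bracket (x : ℂ)) * S) * Complex.I_sq

/-! ### Cut-offs -/

theorem IsCutoff.hasCompactSupport {ψ : ℝ → ℂ} (hψ : IsCutoff ψ) : HasCompactSupport ψ := by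
  refine HasCompactSupport.of_support_subset_isCompact (isCompact_Icc (a := (-2 : ℝ)) (b := 2)) ?_
  intro s hs
  by_contra h
  refine hs (hψ.eq_zero s ?_)
  rw [mem_Icc, ← abs_le] at h
  exact (not_le.1 h).le

theorem IsCutoff.exists_norm_le {ψ : ℝ → ℂ} (hψ : IsCutoff ψ) : ∃ K : ℝ, ∀ t, ‖ψ t‖ ≤ K :=
  hψ.smooth.continuous.bounded_above_of_compact_support hψ.hasCompactSupport

/-- The derivative of a cut-off vanishes to every order at the origin. -/
theorem IsCutoff.exists_norm_deriv_le {ψ : ℝ → ℂ} (hψ : IsCutoff ψ) (n : ℕ) :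
    ∃ K : ℝ, 0 ≤ K ∧ ∀ t, ‖deriv ψ t‖ ≤ K * |t| ^ n := by
  obtain ⟨K, hK⟩ := (hψ.smooth.continuous_deriv (by simp)).bounded_above_of_compact_support
    hψ.hasCompactSupport.deriv
  have hK0 : 0 ≤ K := (norm_nonneg _).trans (hK 0)
  refine ⟨K, hK0, fun t => ?_⟩
  rcases lt_or_ge |t| 1 with ht | ht
  · have : ψ =ᶠ[𝓝 t] fun _ => 1 := by
      filter_upwards [(isOpen_lt continuous_abs continuous_const).mem_nhds ht] with s hs
      exact hψ.eq_one s (le_of_lt hs)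
    rw [this.deriv_eq, deriv_const, norm_zero]
    positivity
  · exact (hK t).trans (le_mul_of_one_le_right hK0 (one_le_pow₀ ht))

/-! ### Bounds for almost analytic extensions -/

theorem symbolClass_mono {β γ : ℝ} (h : β ≤ γ) : symbolClass β ⊆ symbolClass γ := by
  rintro f ⟨hf, hb⟩
  refine ⟨hf, fun n => ?_⟩
  obtain ⟨c, hc, h1⟩ := hb n
  refine ⟨c, hc, fun x => (h1 x).trans ?_⟩
  gcongr
  exact one_le_bracket _

theorem norm_taylor_term_le {a : ℂ} {β c : ℝ} {r : ℕ} {x : ℝ}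
    (h : ‖a‖ ≤ c * bracket (x : ℂ) ^ (β - r)) (y : ℝ) :
    ‖a * (Complex.I * (y : ℂ)) ^ r / (r.factorial : ℂ)‖ ≤
      c * bracket (x : ℂ) ^ β * (|y| / bracket (x : ℂ)) ^ r := by
  have hb := bracket_pos (x : ℂ)
  rw [norm_div, norm_mul, norm_pow, norm_mul, Complex.norm_I, one_mul, Complex.norm_real,
    Real.norm_eq_abs, Complex.norm_natCast]
  have h1 : (1 : ℝ) ≤ r.factorial := by exact_mod_cast r.factorial_pos
  calc _ ≤ ‖a‖ * |y| ^ r := div_le_self (by positivity) h1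
    _ ≤ c * bracket (x : ℂ) ^ (β - r) * |y| ^ r := by gcongr
    _ = _ := by
      rw [Real.rpow_sub hb, Real.rpow_natCast, div_pow]
      field_simp

theorem exists_norm_taylorSum_le {f : ℝ → ℂ} {β : ℝ} (hf : f ∈ symbolClass β) (n : ℕ) :
    ∃ C : ℝ, 0 ≤ C ∧ ∀ x y : ℝ, |y| ≤ 2 * bracket (x : ℂ) →
      ‖taylorSum n f x y‖ ≤ C * bracket (x : ℂ) ^ β := by
  choose c hc hb using hf.2
  refine ⟨∑ r ∈ Finset.range (n + 1), c r * 2 ^ r,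
    Finset.sum_nonneg fun r _ => mul_nonneg (hc r).le (by positivity), fun x y hy => ?_⟩
  rw [Finset.sum_mul]
  refine norm_sum_le_of_le _ fun r _ => (norm_taylor_term_le (hb r x) y).trans ?_
  have hx := bracket_pos (x : ℂ)
  have hs : |y| / bracket (x : ℂ) ≤ 2 := by rwa [div_le_iff₀ hx]
  have := (hc r).le
  calc _ ≤ c r * bracket (x : ℂ) ^ β * 2 ^ r := by gcongr
    _ = _ := by ring

theorem exists_norm_taylorSum_sub_le {f : ℝ → ℂ} {β : ℝ} (hf : f ∈ symbolClass β) {p n : ℕ}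
    (hpn : p ≤ n) :
    ∃ C : ℝ, 0 ≤ C ∧ ∀ x y : ℝ, |y| ≤ bracket (x : ℂ) →
      ‖taylorSum n f x y - taylorSum p f x y‖ ≤
        C * bracket (x : ℂ) ^ β * (|y| / bracket (x : ℂ)) ^ (p + 1) := by
  choose c hc hb using hf.2
  refine ⟨∑ r ∈ Finset.Ico (p + 1) (n + 1), c r,
    Finset.sum_nonneg fun r _ => (hc r).le, fun x y hy => ?_⟩
  rw [taylorSum, taylorSum, ← Finset.sum_Ico_eq_sub _ (by lia), Finset.sum_mul, Finset.sum_mul]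
  refine norm_sum_le_of_le _ fun r hr => (norm_taylor_term_le (hb r x) y).trans ?_
  have hx := bracket_pos (x : ℂ)
  have hs : |y| / bracket (x : ℂ) ≤ 1 := by rwa [div_le_iff₀ hx, one_mul]
  have := (hc r).le
  exact mul_le_mul_of_nonneg_left
    (pow_le_pow_of_le_one (by positivity) hs (Finset.mem_Ico.1 hr).1) (by positivity)

theorem almostAnalytic_eq_zero {ψ : ℝ → ℂ} (hψ : IsCutoff ψ) (n : ℕ) (f : ℝ → ℂ) {x y : ℝ}
    (h : 2 * bracket (x : ℂ) ≤ |y|) : almostAnalytic n ψ f x y = 0 := by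
  have hx := bracket_pos (x : ℂ)
  rw [almostAnalytic_eq, hψ.eq_zero, mul_zero]
  rwa [abs_div, abs_of_pos hx, le_div_iff₀ hx]

theorem exists_norm_almostAnalytic_le {f ψ : ℝ → ℂ} {β : ℝ} (hf : f ∈ symbolClass β)
    (hψ : IsCutoff ψ) (n : ℕ) :
    ∃ C : ℝ, 0 ≤ C ∧ ∀ x y : ℝ, ‖almostAnalytic n ψ f x y‖ ≤ C * bracket (x : ℂ) ^ β := by
  obtain ⟨C, hC, h⟩ := exists_norm_taylorSum_le hf n
  obtain ⟨K, hK⟩ := hψ.exists_norm_le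
  have hK0 : 0 ≤ K := (norm_nonneg _).trans (hK 0)
  refine ⟨C * K, by positivity, fun x y => ?_⟩
  have hx := bracket_pos (x : ℂ)
  rcases le_or_gt |y| (2 * bracket (x : ℂ)) with hy | hy
  · rw [almostAnalytic_eq, norm_mul]
    calc _ ≤ C * bracket (x : ℂ) ^ β * K := by
          gcongr
          exacts [h x y hy, hK _]
      _ = _ := by ring
  · rw [almostAnalytic_eq_zero hψ n f hy.le, norm_zero]
    positivity

theorem dbar_almostAnalytic_eq_zero {f ψ : ℝ → ℂ} (hψ : IsCutoff ψ)
    (n : ℕ) {x y : ℝ} (h : 2 * bracket (x : ℂ) < |y|) : dbar (almostAnalytic n ψ f) x y = 0 := by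
  have h1 : (fun s => almostAnalytic n ψ f s y) =ᶠ[𝓝 x] fun _ => 0 := by
    filter_upwards [(isOpen_lt (continuous_const.mul contDiff_bracket.continuous)
      continuous_const).mem_nhds h] with s hs
    exact almostAnalytic_eq_zero hψ n f (le_of_lt hs)
  have h2 : (fun t => almostAnalytic n ψ f x t) =ᶠ[𝓝 y] fun _ => 0 := by
    filter_upwards [(isOpen_lt continuous_const continuous_abs).mem_nhds h] with t ht
    exact almostAnalytic_eq_zero hψ n f (le_of_lt ht)
  rw [dbar, h1.deriv_eq, h2.deriv_eq]
  simp

/-- The top order Taylor term gives the factor `(|y| / ⟨x⟩)^n`; the terms in which the cut-off is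
differentiated are supported in `⟨x⟩ ≤ |y|` and satisfy the same bound. -/
theorem exists_norm_dbar_almostAnalytic_le {f ψ : ℝ → ℂ} {β : ℝ} (hf : f ∈ symbolClass β)
    (hψ : IsCutoff ψ) (n : ℕ) :
    ∃ C : ℝ, 0 ≤ C ∧ ∀ x y : ℝ, |y| ≤ 2 * bracket (x : ℂ) →
      ‖dbar (almostAnalytic n ψ f) x y‖ ≤
        C * bracket (x : ℂ) ^ (β - 1) * (|y| / bracket (x : ℂ)) ^ n := by
  obtain ⟨C, hC, hT⟩ := exists_norm_taylorSum_le hf n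
  obtain ⟨K, hK⟩ := hψ.exists_norm_le
  obtain ⟨K', hK0', hK'⟩ := hψ.exists_norm_deriv_le n
  obtain ⟨c, hc, hcf⟩ := hf.2 (n + 1)
  have hK0 : 0 ≤ K := (norm_nonneg _).trans (hK 0)
  refine ⟨c * K + C * K' * 3, by positivity, fun x y hy => ?_⟩
  have hx := bracket_pos (x : ℂ)
  have hs : |y| / bracket (x : ℂ) ≤ 2 := by rwa [div_le_iff₀ hx]
  have h1 : ‖iteratedDeriv (n + 1) f x * (Complex.I * (y : ℂ)) ^ n / (n.factorial : ℂ)‖ ≤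
      c * bracket (x : ℂ) ^ (β - 1) * (|y| / bracket (x : ℂ)) ^ n := by
    have hcf' := hcf x
    have e : β - ((n + 1 : ℕ) : ℝ) = β - 1 - n := by push_cast; ring
    rw [e] at hcf'
    exact norm_taylor_term_le hcf' y
  have h2 : ‖Complex.I - ((y / bracket (x : ℂ) * (x / bracket (x : ℂ)) : ℝ) : ℂ)‖ ≤ 3 := by
    refine (norm_sub_le _ _).trans ?_
    have h3 : |x| / bracket (x : ℂ) ≤ 1 := (div_le_one hx).2 (abs_le_bracket x)
    rw [Complex.norm_I, Complex.norm_real, Real.norm_eq_abs, abs_mul, abs_div, abs_div,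
      abs_of_pos hx]
    nlinarith [div_nonneg (abs_nonneg x) hx.le, div_nonneg (abs_nonneg y) hx.le]
  have h3 := hK' (y / bracket (x : ℂ))
  rw [abs_div, abs_of_pos hx] at h3
  have h4 : ‖(((bracket (x : ℂ))⁻¹ : ℝ) : ℂ)‖ = (bracket (x : ℂ))⁻¹ := by
    rw [Complex.norm_real, Real.norm_of_nonneg (by positivity)]
  rw [dbar_almostAnalytic hf.1 hψ.smooth, norm_mul]
  have h5 : ‖(1 / 2 : ℂ)‖ ≤ 1 := by norm_num
  refine (mul_le_of_le_one_left (norm_nonneg _) h5).trans ((norm_add_le _ _).trans ?_)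
  rw [norm_mul, norm_mul _ (Complex.I - _), norm_mul _ (((bracket (x : ℂ))⁻¹ : ℝ) : ℂ),
    norm_mul (taylorSum n f x y), h4, add_mul, add_mul]
  refine add_le_add ?_ ?_
  · calc _ ≤ (c * bracket (x : ℂ) ^ (β - 1) * (|y| / bracket (x : ℂ)) ^ n) * K := by
          gcongr
          exact hK _
      _ = _ := by ring
  · have h6 := hT x y hy
    calc _ ≤ C * bracket (x : ℂ) ^ β * (K' * (|y| / bracket (x : ℂ)) ^ n) *
            (bracket (x : ℂ))⁻¹ * 3 := by gcongr
      _ = _ := by rw [Real.rpow_sub_one hx.ne']; ring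

/-- Two functions that agree on the half line have the same derivatives there, including at the
end point. -/
theorem iteratedDeriv_eq_of_eqOn_Ici {f g : ℝ → ℂ} (hf : ContDiff ℝ (⊤ : ℕ∞) f)
    (hg : ContDiff ℝ (⊤ : ℕ∞) g) (hfg : EqOn f g (Ici 0)) (r : ℕ) :
    EqOn (iteratedDeriv r f) (iteratedDeriv r g) (Ici 0) := by
  have h : EqOn (iteratedDeriv r f) (iteratedDeriv r g) (Ioi 0) :=
    (hfg.mono Ioi_subset_Ici_self).iteratedDeriv_of_isOpen isOpen_Ioi r
  have := h.closure (contDiff_iteratedDeriv hf r).continuous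
    (contDiff_iteratedDeriv hg r).continuous
  rwa [closure_Ioi] at this

/-- Over the half line where `f` and `g` agree, their almost analytic extensions of orders at
least `p` differ by a function vanishing to order `p + 1` on the real axis, whatever the
cut-offs. -/
theorem exists_norm_almostAnalytic_sub_le {f g ψ χ : ℝ → ℂ} {β : ℝ} (hf : f ∈ symbolClass β)
    (hg : g ∈ symbolClass β) (hfg : EqOn f g (Ici 0)) (hψ : IsCutoff ψ) (hχ : IsCutoff χ)
    {p n m : ℕ} (hn : p ≤ n) (hm : p ≤ m) :
    ∃ C : ℝ, 0 ≤ C ∧ ∀ x y : ℝ, 0 ≤ x →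
      ‖almostAnalytic n ψ f x y - almostAnalytic m χ g x y‖ ≤
        C * bracket (x : ℂ) ^ β * (|y| / bracket (x : ℂ)) ^ (p + 1) := by
  obtain ⟨C₁, hC₁, h₁⟩ := exists_norm_almostAnalytic_le hf hψ n
  obtain ⟨C₂, hC₂, h₂⟩ := exists_norm_almostAnalytic_le hg hχ m
  obtain ⟨C₃, hC₃, h₃⟩ := exists_norm_taylorSum_sub_le hf hn
  obtain ⟨C₄, hC₄, h₄⟩ := exists_norm_taylorSum_sub_le hg hm
  refine ⟨max (C₁ + C₂) (C₃ + C₄), by positivity, fun x y hx0 => ?_⟩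
  have hx := bracket_pos (x : ℂ)
  rcases le_or_gt |y| (bracket (x : ℂ)) with hy | hy
  · have hs : |y / bracket (x : ℂ)| ≤ 1 := by rwa [abs_div, abs_of_pos hx, div_le_one hx]
    have hT : taylorSum p f x y = taylorSum p g x y :=
      Finset.sum_congr rfl fun r _ => by
        rw [iteratedDeriv_eq_of_eqOn_Ici hf.1 hg.1 hfg r hx0]
    rw [almostAnalytic_eq, almostAnalytic_eq, hψ.eq_one _ hs, hχ.eq_one _ hs, mul_one, mul_one]
    have e : taylorSum n f x y - taylorSum m g x y = (taylorSum n f x y - taylorSum p f x y) -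
        (taylorSum m g x y - taylorSum p g x y) := by rw [hT]; ring
    rw [e]
    calc _ ≤ _ := (norm_sub_le _ _).trans (add_le_add (h₃ x y hy) (h₄ x y hy))
      _ = (C₃ + C₄) * bracket (x : ℂ) ^ β * (|y| / bracket (x : ℂ)) ^ (p + 1) := by ring
      _ ≤ _ := by gcongr; exact le_max_right _ _
  · have hs : 1 ≤ (|y| / bracket (x : ℂ)) ^ (p + 1) :=
      one_le_pow₀ ((one_le_div hx).2 hy.le)
    calc _ ≤ _ := (norm_sub_le _ _).trans (add_le_add (h₁ x y) (h₂ x y))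
      _ = (C₁ + C₂) * bracket (x : ℂ) ^ β * 1 := by ring
      _ ≤ _ := by gcongr; exact le_max_left _ _

/-! ### The operator `∂/∂z̄` -/

/-- For a differentiable `F` the partial derivatives in `dbar` come from the total derivative. -/
theorem dbar_eq_fderiv {F : ℝ → ℝ → ℂ} {p : ℝ × ℝ}
    (hF : DifferentiableAt ℝ (fun p : ℝ × ℝ => F p.1 p.2) p) :
    dbar F p.1 p.2 = (1 / 2 : ℂ) * (fderiv ℝ (fun p : ℝ × ℝ => F p.1 p.2) p (1, 0) +
      Complex.I * fderiv ℝ (fun p : ℝ × ℝ => F p.1 p.2) p (0, 1)) := by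
  have h1 : HasDerivAt (fun s => F s p.2) (fderiv ℝ (fun p : ℝ × ℝ => F p.1 p.2) p (1, 0)) p.1 :=
    HasFDerivAt.comp_hasDerivAt (l := fun p : ℝ × ℝ => F p.1 p.2) p.1 hF.hasFDerivAt
      ((hasDerivAt_id p.1).prodMk (hasDerivAt_const p.1 p.2))
  have h2 : HasDerivAt (fun t => F p.1 t) (fderiv ℝ (fun p : ℝ × ℝ => F p.1 p.2) p (0, 1)) p.2 :=
    HasFDerivAt.comp_hasDerivAt (l := fun p : ℝ × ℝ => F p.1 p.2) p.2 hF.hasFDerivAt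
      ((hasDerivAt_const p.2 p.1).prodMk (hasDerivAt_id p.2))
  rw [dbar, h1.deriv, h2.deriv]

theorem continuous_dbar {F : ℝ → ℝ → ℂ} (hF : ContDiff ℝ 1 (fun p : ℝ × ℝ => F p.1 p.2)) :
    Continuous fun p : ℝ × ℝ => dbar F p.1 p.2 := by
  have h := hF.continuous_fderiv one_ne_zero
  simp only [fun p => dbar_eq_fderiv (hF.differentiable one_ne_zero p)]
  fun_prop

theorem dbar_sub {F G : ℝ → ℝ → ℂ} (hF : ContDiff ℝ 1 (fun p : ℝ × ℝ => F p.1 p.2))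
    (hG : ContDiff ℝ 1 (fun p : ℝ × ℝ => G p.1 p.2)) (p : ℝ × ℝ) :
    dbar (fun x y => F x y - G x y) p.1 p.2 = dbar F p.1 p.2 - dbar G p.1 p.2 := by
  have h1 := hF.differentiable one_ne_zero p
  have h2 := hG.differentiable one_ne_zero p
  rw [dbar_eq_fderiv h1, dbar_eq_fderiv h2, dbar_eq_fderiv (h1.fun_sub h2), fderiv_fun_sub h1 h2]
  simp only [sub_apply]
  ring

/-! ### Absolute convergence -/

theorem integrable_indicator_abs_rpow {γ : ℝ} (hγ : -1 < γ) :
    Integrable ((Icc (-2 : ℝ) 2).indicator fun t : ℝ => |t| ^ γ) := by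
  rw [integrable_indicator_iff measurableSet_Icc]
  have h1 : IntervalIntegrable (fun t : ℝ => |t| ^ γ) volume 0 2 := by
    refine (intervalIntegral.intervalIntegrable_rpow' hγ).congr fun t ht => ?_
    rw [uIoc_of_le (by norm_num)] at ht
    simp only [abs_of_pos ht.1]
  have h2 : IntervalIntegrable (fun t : ℝ => |t| ^ γ) volume (-2) 0 := by
    rw [IntervalIntegrable.iff_comp_neg]
    simpa using h1.symm
  rw [integrableOn_Icc_iff_integrableOn_Ioc, ← intervalIntegrable_iff_integrableOn_Ioc_of_le
    (by norm_num)]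
  exact h2.trans h1

theorem integrable_bracket_rpow {r : ℝ} (hr : r < -1) :
    Integrable fun x : ℝ => bracket (x : ℂ) ^ r := by
  have h := integrable_rpow_neg_one_add_norm_sq (E := ℝ) (μ := volume) (r := -r)
    (by simpa using by linarith)
  refine h.congr (Eventually.of_forall fun x => ?_)
  simp only [bracket_ofReal]
  rw [Real.sqrt_eq_rpow, ← Real.rpow_mul (by positivity), Real.norm_eq_abs, sq_abs]
  ring_nf

/-- A function homogeneous in `(⟨x⟩, y)` is integrable as soon as its profile in `y / ⟨x⟩` is. -/
theorem integrable_bracket_rpow_mul_comp_div {r : ℝ} (hr : r < -2) {q : ℝ → ℝ}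
    (hq : Integrable q) (hqm : Measurable q) :
    Integrable fun p : ℝ × ℝ => bracket (p.1 : ℂ) ^ r * q (p.2 / bracket (p.1 : ℂ)) := by
  have hbm : Measurable fun x : ℝ => bracket (x : ℂ) := contDiff_bracket.continuous.measurable
  have hm : Measurable fun p : ℝ × ℝ => bracket (p.1 : ℂ) ^ r * q (p.2 / bracket (p.1 : ℂ)) :=
    ((hbm.comp measurable_fst).pow_const r).mul
      (hqm.comp (measurable_snd.div (hbm.comp measurable_fst)))
  rw [Measure.volume_eq_prod, integrable_prod_iff hm.aestronglyMeasurable]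
  refine ⟨Eventually.of_forall fun x => (hq.comp_div (bracket_pos (x : ℂ)).ne').const_mul
    (bracket (x : ℂ) ^ r), ?_⟩
  have h : ∀ x : ℝ, ∫ y, ‖bracket (x : ℂ) ^ r * q (y / bracket (x : ℂ))‖ =
      bracket (x : ℂ) ^ (r + 1) * ∫ t, ‖q t‖ := fun x => by
    have hb := bracket_pos (x : ℂ)
    simp only [norm_mul]
    rw [integral_const_mul, Measure.integral_comp_div (fun t => ‖q t‖), abs_of_pos hb, smul_eq_mul,
      Real.norm_of_nonneg (by positivity), Real.rpow_add_one hb.ne', mul_assoc]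
  simp only [h]
  exact (integrable_bracket_rpow (by linarith)).mul_const _

theorem ae_snd_ne_zero : ∀ᵐ p : ℝ × ℝ, p.2 ≠ 0 := by
  have h : ∀ᵐ y : ℝ, y ≠ 0 := compl_mem_ae_iff.2 (measure_singleton 0)
  exact (Measure.quasiMeasurePreserving_snd (μ := (volume : Measure ℝ))
    (ν := (volume : Measure ℝ))).ae h

/-- Off the real axis the integrand is dominated, uniformly in the operator function, by a multiple
of one integrable function. -/
theorem exists_dominating {E : Type*} [NormedAddCommGroup E] [NormedSpace ℂ E] {f ψ : ℝ → ℂ}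
    {α β : ℝ} (hα : 0 ≤ α) (hβ : β < 0) (hf : f ∈ symbolClass β) (hψ : IsCutoff ψ) {n : ℕ}
    (hn : α < n) :
    ∃ D : ℝ × ℝ → ℝ, Integrable D ∧ ∀ (c : ℝ) (Φ : ℂ → E), ResolventGrowth α c Φ →
      ∀ p : ℝ × ℝ, p.2 ≠ 0 →
        ‖dbar (almostAnalytic n ψ f) p.1 p.2 • Φ (p.1 + p.2 * Complex.I)‖ ≤ c * D p := by
  obtain ⟨C, hC, hle⟩ := exists_norm_dbar_almostAnalytic_le hf hψ n
  have hq := integrable_indicator_abs_rpow (γ := n - 1 - α) (by linarith)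
  have hqm : Measurable ((Icc (-2 : ℝ) 2).indicator fun t : ℝ => |t| ^ (n - 1 - α)) :=
    (measurable_norm.pow_const _).indicator measurableSet_Icc
  refine ⟨_, (integrable_bracket_rpow_mul_comp_div (r := β - 2) (by linarith) hq hqm).const_mul
    (C * 3 ^ α), fun c Φ hΦ p hp => ?_⟩
  obtain ⟨x, y⟩ := p
  simp only at hp ⊢
  have hb := bracket_pos (x : ℂ)
  have hc := hΦ.nonneg
  have hy := abs_pos.2 hp
  have habs : |y / bracket (x : ℂ)| = |y| / bracket (x : ℂ) := by rw [abs_div, abs_of_pos hb]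
  rcases le_or_gt |y| (2 * bracket (x : ℂ)) with hxy | hxy
  · have hmem : y / bracket (x : ℂ) ∈ Icc (-2 : ℝ) 2 := by
      rwa [mem_Icc, ← abs_le, habs, div_le_iff₀ hb]
    rw [norm_smul, indicator_of_mem hmem, habs]
    calc _ ≤ C * bracket (x : ℂ) ^ (β - 1) * (|y| / bracket (x : ℂ)) ^ n *
          (c * 3 ^ α * (bracket (x : ℂ))⁻¹ * (|y| / bracket (x : ℂ)) ^ (-1 - α)) := by
          gcongr
          exacts [hle x y hxy, hΦ.norm_le hα hp hxy]
      _ = _ := by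
          have e1 : (n : ℝ) - 1 - α = n + (-1 - α) := by ring
          have e2 : β - 2 = β - 1 - 1 := by ring
          rw [e1, e2, Real.rpow_add (by positivity), Real.rpow_natCast,
            Real.rpow_sub_one hb.ne' (β - 1)]
          ring
  · have hmem : y / bracket (x : ℂ) ∉ Icc (-2 : ℝ) 2 := by
      rw [mem_Icc, ← abs_le, habs, div_le_iff₀ hb]
      exact not_le.2 hxy
    rw [dbar_almostAnalytic_eq_zero hψ n hxy, indicator_of_notMem hmem]
    simp

theorem aestronglyMeasurable_dbar_smul {E : Type*} [NormedAddCommGroup E] [NormedSpace ℂ E]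
    {F : ℝ → ℝ → ℂ} (hF : ContDiff ℝ 1 (fun p : ℝ × ℝ => F p.1 p.2)) {Φ : ℂ → E}
    (hΦ : ∀ z : ℂ, z.im ≠ 0 → ContinuousAt Φ z) :
    AEStronglyMeasurable
      (fun p : ℝ × ℝ => dbar F p.1 p.2 • Φ (p.1 + p.2 * Complex.I)) := by
  have hopen : IsOpen {p : ℝ × ℝ | p.2 ≠ 0} := isOpen_ne_fun continuous_snd continuous_const
  have h : ContinuousOn (fun p : ℝ × ℝ => dbar F p.1 p.2 • Φ (p.1 + p.2 * Complex.I))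
      {p : ℝ × ℝ | p.2 ≠ 0} := fun p hp => by
    refine ((continuous_dbar hF).continuousAt.smul ?_).continuousWithinAt
    exact ContinuousAt.comp (f := fun p : ℝ × ℝ => (p.1 : ℂ) + p.2 * Complex.I)
      (hΦ _ (by simpa using hp)) (by fun_prop)
  have h2 := h.aestronglyMeasurable hopen.measurableSet (μ := volume)
  have e : volume.restrict {p : ℝ × ℝ | p.2 ≠ 0} = volume :=
    Measure.restrict_eq_self_of_ae_mem ae_snd_ne_zero
  rwa [e] at h2

/-! ### Stokes' theorem on the slit plane -/

section Stokes

variable {E : Type*} [NormedAddCommGroup E] [NormedSpace ℂ E]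

/-- `∂/∂z̄ (F Φ) = (∂F/∂z̄) Φ` where `Φ` is holomorphic. -/
theorem fderiv_smul_add_I_smul {F : ℝ → ℝ → ℂ} {Φ : ℂ → E} {p : ℝ × ℝ}
    (hF : DifferentiableAt ℝ (fun p : ℝ × ℝ => F p.1 p.2) p)
    (hΦ : DifferentiableAt ℂ Φ (p.1 + p.2 * Complex.I)) :
    DifferentiableAt ℝ (fun p : ℝ × ℝ => F p.1 p.2 • Φ (p.1 + p.2 * Complex.I)) p ∧
      fderiv ℝ (fun p : ℝ × ℝ => F p.1 p.2 • Φ (p.1 + p.2 * Complex.I)) p (1, 0) +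
        Complex.I • fderiv ℝ (fun p : ℝ × ℝ => F p.1 p.2 • Φ (p.1 + p.2 * Complex.I)) p (0, 1) =
      (2 : ℂ) • dbar F p.1 p.2 • Φ (p.1 + p.2 * Complex.I) := by
  have hι : HasFDerivAt (fun p : ℝ × ℝ => (p.1 : ℂ) + p.2 * Complex.I)
      (Complex.ofRealCLM.comp (ContinuousLinearMap.fst ℝ ℝ ℝ) +
        (Complex.I • Complex.ofRealCLM).comp (ContinuousLinearMap.snd ℝ ℝ ℝ)) p := by
    have h := (Complex.ofRealCLM.comp (ContinuousLinearMap.fst ℝ ℝ ℝ) +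
        (Complex.I • Complex.ofRealCLM).comp (ContinuousLinearMap.snd ℝ ℝ ℝ)).hasFDerivAt (x := p)
    refine h.congr_of_eventuallyEq (Eventually.of_forall fun q => ?_)
    simp [mul_comm]
  have hΦ' := (hΦ.hasFDerivAt.restrictScalars ℝ).comp p hι
  have h := hF.hasFDerivAt.smul hΦ'
  have h' : HasFDerivAt (fun p : ℝ × ℝ => F p.1 p.2 • Φ (p.1 + p.2 * Complex.I)) _ p := h
  refine ⟨h'.differentiableAt, ?_⟩
  rw [h'.fderiv, dbar_eq_fderiv hF]
  have hI : fderiv ℂ Φ (p.1 + p.2 * Complex.I) Complex.I =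
      Complex.I • fderiv ℂ Φ (p.1 + p.2 * Complex.I) 1 := by
    rw [← map_smul, smul_eq_mul, mul_one]
  simp [hI, smul_smul]
  have : Complex.I * (F p.1 p.2 * Complex.I) = - F p.1 p.2 := by
    linear_combination (F p.1 p.2) * Complex.I_mul_I
  rw [this]
  module

theorem volume_realAxis : volume ({p : ℝ × ℝ | p.2 = 0}) = 0 := by
  have := ae_snd_ne_zero
  rw [ae_iff] at this
  simpa using this

/-- Stokes' theorem over a rectangle crossing the real axis, for a function that is differentiable
only off the real axis: the contributions of the axis from above and below cancel by continuity. -/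
theorem setIntegral_rect_eq [CompleteSpace E] {G : ℝ × ℝ → E} (hG : Continuous G)
    (hd : ∀ p : ℝ × ℝ, p.2 ≠ 0 → DifferentiableAt ℝ G p) {k : ℝ × ℝ → E}
    (hk : ∀ p : ℝ × ℝ, p.2 ≠ 0 → fderiv ℝ G p (1, 0) + Complex.I • fderiv ℝ G p (0, 1) = k p)
    (hint : Integrable k) {a b M : ℝ} (hab : a ≤ b) (hM : 0 ≤ M) :
    ∫ p in Icc (a, -M) (b, M), k p =
      Complex.I • ((∫ x in a..b, G (x, M)) - ∫ x in a..b, G (x, -M)) +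
        ((∫ y in -M..M, G (b, y)) - ∫ y in -M..M, G (a, y)) := by
  have key : ∀ u v : ℝ, u ≤ v → (∀ p : ℝ × ℝ, p.2 ∈ Ioo u v → p.2 ≠ 0) →
      ∫ p in Icc (a, u) (b, v), k p =
        Complex.I • ((∫ x in a..b, G (x, v)) - ∫ x in a..b, G (x, u)) +
          ((∫ y in u..v, G (b, y)) - ∫ y in u..v, G (a, y)) := by
    intro u v huv hne
    have hae : (fun p => fderiv ℝ G p (1, 0) + (Complex.I • fderiv ℝ G p) (0, 1)) =ᵐ[volume] k := by
      filter_upwards [ae_snd_ne_zero] with p hp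
      exact hk p hp
    have h := integral_divergence_prod_Icc_of_hasFDerivAt_of_le G (fun p => Complex.I • G p)
      (fderiv ℝ G) (fun p => Complex.I • fderiv ℝ G p) (a, u) (b, v) ⟨hab, huv⟩ hG.continuousOn
      (hG.const_smul Complex.I).continuousOn (fun p hp => (hd p (hne p hp.2)).hasFDerivAt)
      (fun p hp => (hd p (hne p hp.2)).hasFDerivAt.const_smul Complex.I)
      ((hint.congr hae.symm).integrableOn)
    rw [integral_congr_ae (ae_restrict_of_ae hae)] at h
    rw [h]
    simp only [intervalIntegral.integral_smul, smul_sub]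
    abel
  have hup := key 0 M hM fun p hp => hp.1.ne'
  have hlo := key (-M) 0 (by linarith) fun p hp => hp.2.ne
  have hunion : Icc (a, -M) (b, M) = Icc (a, -M) (b, 0) ∪ Icc (a, 0) (b, M) := by
    rw [← Icc_prod_Icc, ← Icc_prod_Icc, ← Icc_prod_Icc, ← prod_union,
      Icc_union_Icc_eq_Icc (by linarith) hM]
  have hdisj : AEDisjoint volume (Icc (a, -M) (b, 0)) (Icc (a, (0 : ℝ)) (b, M)) :=
    measure_mono_null (fun p hp => le_antisymm hp.1.2.2 hp.2.1.2) volume_realAxis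
  have hii : ∀ x u v : ℝ, IntervalIntegrable (fun y => G (x, y)) volume u v := fun x u v =>
    (hG.comp (by fun_prop : Continuous fun y : ℝ => (x, y))).intervalIntegrable u v
  rw [hunion, setIntegral_union₀ hdisj measurableSet_Icc.nullMeasurableSet hint.integrableOn
    hint.integrableOn, hup, hlo,
    ← intervalIntegral.integral_add_adjacent_intervals (hii b (-M) 0) (hii b 0 M),
    ← intervalIntegral.integral_add_adjacent_intervals (hii a (-M) 0) (hii a 0 M)]
  simp only [smul_sub]
  abel

/-- Over `x ≥ 0` the zero of `F` on the real axis absorbs the singularity of `Φ`. On the axis itself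
the bound holds whatever the value of `Φ`, because `F` vanishes there. -/
theorem exists_norm_smul_le_right {F : ℝ → ℝ → ℂ} {Φ : ℂ → E} {α c β C q : ℝ} (hα : 0 ≤ α)
    (hΦ : ResolventGrowth α c Φ) (hq : α < q) (hC : 0 ≤ C)
    (hzero : ∀ x y : ℝ, 2 * bracket (x : ℂ) ≤ |y| → F x y = 0)
    (hle : ∀ x y : ℝ, 0 ≤ x →
      ‖F x y‖ ≤ C * bracket (x : ℂ) ^ β * (|y| / bracket (x : ℂ)) ^ (q + 1)) :
    ∃ K : ℝ, 0 ≤ K ∧ ∀ x y : ℝ, 0 ≤ x → ‖F x y • Φ (x + y * Complex.I)‖ ≤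
      K * bracket (x : ℂ) ^ (β - 1) * (|y| / bracket (x : ℂ)) ^ (q - α) := by
  have hc := hΦ.nonneg
  refine ⟨C * (c * 3 ^ α), by positivity, fun x y hx => ?_⟩
  have hb := bracket_pos (x : ℂ)
  have hF := hle x y hx
  rcases eq_or_ne y 0 with rfl | hy
  · rw [abs_zero, zero_div, Real.zero_rpow (by linarith), mul_zero] at hF
    rw [norm_le_zero_iff.1 hF, zero_smul, norm_zero]
    positivity
  rcases lt_or_ge (2 * bracket (x : ℂ)) |y| with hxy | hxy
  · rw [hzero x y hxy.le, zero_smul, norm_zero]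
    positivity
  have hy' := abs_pos.2 hy
  rw [norm_smul]
  calc _ ≤ C * bracket (x : ℂ) ^ β * (|y| / bracket (x : ℂ)) ^ (q + 1) *
        (c * 3 ^ α * (bracket (x : ℂ))⁻¹ * (|y| / bracket (x : ℂ)) ^ (-1 - α)) := by
        gcongr
        exact hΦ.norm_le hα hy hxy
    _ = _ := by
        have e : q - α = (q + 1) + (-1 - α) := by ring
        rw [e, Real.rpow_add (by positivity) (q + 1), Real.rpow_sub_one hb.ne']
        ring

/-- The product `F Φ` extends continuously by zero across the part of the real axis where `Φ` is
singular. -/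
theorem continuous_smul_of_growth {F : ℝ → ℝ → ℂ} {Φ : ℂ → E} {δ r K t : ℝ} (hδ : 0 < δ)
    (hF : Continuous fun p : ℝ × ℝ => F p.1 p.2)
    (hΦd : ∀ z : ℂ, z.im ≠ 0 ∨ z.re < δ → DifferentiableAt ℂ Φ z) (ht : 0 < t)
    (hK : ∀ x y : ℝ, 0 ≤ x → ‖F x y • Φ (x + y * Complex.I)‖ ≤
      K * bracket (x : ℂ) ^ r * (|y| / bracket (x : ℂ)) ^ t) :
    Continuous fun p : ℝ × ℝ => F p.1 p.2 • Φ (p.1 + p.2 * Complex.I) := by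
  rw [continuous_iff_continuousAt]
  rintro ⟨x, y⟩
  by_cases h : y ≠ 0 ∨ x < δ
  · refine hF.continuousAt.smul ?_
    exact ContinuousAt.comp (f := fun p : ℝ × ℝ => (p.1 : ℂ) + p.2 * Complex.I)
      (hΦd _ (by simpa using h)).continuousAt (by fun_prop)
  · push Not at h
    obtain ⟨rfl, hx⟩ := h
    have hbd : Continuous fun p : ℝ × ℝ =>
        K * bracket (p.1 : ℂ) ^ r * (|p.2| / bracket (p.1 : ℂ)) ^ t := by
      have hb : Continuous fun p : ℝ × ℝ => bracket (p.1 : ℂ) :=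
        contDiff_bracket.continuous.comp continuous_fst
      exact (continuous_const.mul (hb.rpow_const fun p => Or.inl (bracket_pos _).ne')).mul
        ((continuous_snd.abs.div hb fun p => (bracket_pos _).ne').rpow_const fun p => Or.inr ht.le)
    have hz : F x 0 • Φ (x + (0 : ℝ) * Complex.I) = 0 := by
      have := hK x 0 (by linarith)
      rw [abs_zero, zero_div, Real.zero_rpow ht.ne', mul_zero] at this
      exact norm_le_zero_iff.1 this
    have hlim := hbd.tendsto (x, (0 : ℝ))
    simp only [abs_zero, zero_div, Real.zero_rpow ht.ne', mul_zero] at hlim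
    rw [ContinuousAt]
    simp only [hz]
    refine squeeze_zero_norm' ?_ hlim
    filter_upwards [(isOpen_lt continuous_const continuous_fst).mem_nhds
      (show (0 : ℝ) < ((x, (0 : ℝ)) : ℝ × ℝ).1 by simpa using by linarith)] with p hp
    exact hK p.1 p.2 (le_of_lt hp)

/-- **Vanishing of the Helffer–Sjöstrand integral.** If `Φ` is holomorphic off `[δ, ∞)` with the
resolvent growth, and `F` vanishes to order higher than `α + 1` on the nonnegative real axis, then
`∬ (∂F/∂z̄) Φ = 0`. -/
theorem integral_dbar_smul_eq_zero [CompleteSpace E] {F : ℝ → ℝ → ℂ} {Φ : ℂ → E}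
    {α c β C C' q δ : ℝ} (hα : 0 ≤ α) (hβ : β < 0) (hδ : 0 < δ)
    (hF : ContDiff ℝ 1 fun p : ℝ × ℝ => F p.1 p.2) (hΦ : ResolventGrowth α c Φ)
    (hΦd : ∀ z : ℂ, z.im ≠ 0 ∨ z.re < δ → DifferentiableAt ℂ Φ z)
    (hq : α < q) (hC : 0 ≤ C) (hC' : 0 ≤ C')
    (hzero : ∀ x y : ℝ, 2 * bracket (x : ℂ) ≤ |y| → F x y = 0)
    (hle' : ∀ x y : ℝ, ‖F x y‖ ≤ C' * bracket (x : ℂ) ^ β)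
    (hle : ∀ x y : ℝ, 0 ≤ x →
      ‖F x y‖ ≤ C * bracket (x : ℂ) ^ β * (|y| / bracket (x : ℂ)) ^ (q + 1))
    (hint : Integrable fun p : ℝ × ℝ => dbar F p.1 p.2 • Φ (p.1 + p.2 * Complex.I)) :
    ∫ p : ℝ × ℝ, dbar F p.1 p.2 • Φ (p.1 + p.2 * Complex.I) = 0 := by
  obtain ⟨K₁, hK₁, hR⟩ := exists_norm_smul_le_right hα hΦ hq hC hzero hle
  obtain ⟨K₂, hL⟩ := hΦ.exists_norm_le_left hα fun z hz => hΦd z (Or.inr (hz.trans hδ))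
  have hcont := continuous_smul_of_growth hδ hF.continuous hΦd (sub_pos.2 hq) hR
  set G : ℝ × ℝ → E := fun p => F p.1 p.2 • Φ (p.1 + p.2 * Complex.I) with hG
  have hGz : ∀ x y : ℝ, 2 * bracket (x : ℂ) ≤ |y| → G (x, y) = 0 := fun x y h => by
    simp only [hG, hzero x y h, zero_smul]
  have hright : ∀ x y : ℝ, 0 ≤ x → ‖G (x, y)‖ ≤ K₁ * 2 ^ (q - α) * bracket (x : ℂ) ^ (β - 1) := by
    intro x y hx
    have hb := bracket_pos (x : ℂ)
    rcases le_or_gt (2 * bracket (x : ℂ)) |y| with hy | hy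
    · rw [hGz x y hy, norm_zero]
      positivity
    have hs : |y| / bracket (x : ℂ) ≤ 2 := (div_le_iff₀ hb).2 hy.le
    have hqα := (sub_pos.2 hq).le
    calc _ ≤ _ := hR x y hx
      _ ≤ K₁ * bracket (x : ℂ) ^ (β - 1) * 2 ^ (q - α) := by gcongr
      _ = _ := by ring
  have hleft : ∀ x y : ℝ, x ≤ -1 → ‖G (x, y)‖ ≤ C' * |K₂| * bracket (x : ℂ) ^ (β - 1) := by
    intro x y hx
    have hb := bracket_pos (x : ℂ)
    rcases le_or_gt (2 * bracket (x : ℂ)) |y| with hy | hy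
    · rw [hGz x y hy, norm_zero]
      positivity
    simp only [hG, norm_smul]
    calc _ ≤ C' * bracket (x : ℂ) ^ β * (|K₂| * (bracket (x : ℂ))⁻¹) := by
          gcongr
          · exact hle' x y
          · exact (hL x y hx hy.le).trans (by gcongr; exact le_abs_self _)
      _ = _ := by
          rw [Real.rpow_sub_one hb.ne']
          ring
  set k : ℝ × ℝ → E := fun p => dbar F p.1 p.2 • Φ (p.1 + p.2 * Complex.I) with hkdef
  have hfd : ∀ p : ℝ × ℝ, p.2 ≠ 0 → _ := fun p hp =>
    fderiv_smul_add_I_smul (hF.differentiable one_ne_zero p) (hΦd _ (Or.inl (by simpa using hp)))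
  -- rectangles just high enough for `F` to vanish on the horizontal sides
  let S : ℕ → Set (ℝ × ℝ) := fun N => Icc (-(N : ℝ), -(2 * bracket ((N : ℝ) : ℂ)))
    ((N : ℝ), 2 * bracket ((N : ℝ) : ℂ))
  have hS : ∀ N : ℕ, 1 ≤ N → ‖∫ p in S N, (2 : ℂ) • k p‖ ≤
      (K₁ * 2 ^ (q - α) + C' * |K₂|) * 4 * bracket ((N : ℝ) : ℂ) ^ β := by
    intro N hN
    have hN' : (1 : ℝ) ≤ N := by exact_mod_cast hN
    have hb := bracket_pos ((N : ℝ) : ℂ)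
    rw [setIntegral_rect_eq hcont (fun p hp => (hfd p hp).1) (fun p hp => (hfd p hp).2)
      (hint.smul (2 : ℂ)) (by linarith) (by positivity)]
    have hxN : ∀ x ∈ uIcc (-(N : ℝ)) N, 2 * bracket (x : ℂ) ≤ 2 * bracket ((N : ℝ) : ℂ) := by
      intro x hx
      rw [uIcc_of_le (by linarith), mem_Icc, ← abs_le] at hx
      gcongr
      exact bracket_le_bracket (hx.trans (le_abs_self _))
    have htop : ∫ x in (-(N : ℝ))..N, G (x, 2 * bracket ((N : ℝ) : ℂ)) = 0 := by
      rw [intervalIntegral.integral_congr (g := fun _ => (0 : E))]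
      · simp
      · intro x hx
        exact hGz x _ (by rw [abs_of_pos (by positivity)]; exact hxN x hx)
    have hbot : ∫ x in (-(N : ℝ))..N, G (x, -(2 * bracket ((N : ℝ) : ℂ))) = 0 := by
      rw [intervalIntegral.integral_congr (g := fun _ => (0 : E))]
      · simp
      · intro x hx
        exact hGz x _ (by rw [abs_neg, abs_of_pos (by positivity)]; exact hxN x hx)
    rw [htop, hbot, sub_zero, smul_zero, zero_add]
    have hbn : bracket ((-(N : ℝ) : ℝ) : ℂ) = bracket ((N : ℝ) : ℂ) := by
      simp [bracket]
    have h1 := intervalIntegral.norm_integral_le_of_norm_le_const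
      (a := -(2 * bracket ((N : ℝ) : ℂ))) (b := 2 * bracket ((N : ℝ) : ℂ))
      fun y _ => hright N y (by positivity)
    have h2 := intervalIntegral.norm_integral_le_of_norm_le_const
      (a := -(2 * bracket ((N : ℝ) : ℂ))) (b := 2 * bracket ((N : ℝ) : ℂ))
      fun y _ => hleft (-N) y (by linarith)
    rw [hbn] at h2
    refine (norm_sub_le _ _).trans ((add_le_add h1 h2).trans_eq ?_)
    rw [Real.rpow_sub_one hb.ne', abs_of_pos (by linarith)]
    field_simp
    ring
  have hmono : Monotone S := by
    intro N N' h
    have h' : (N : ℝ) ≤ N' := by exact_mod_cast h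
    have hb : bracket ((N : ℝ) : ℂ) ≤ bracket ((N' : ℝ) : ℂ) := bracket_le_bracket (by
      rwa [abs_of_nonneg (by positivity), abs_of_nonneg (by positivity)])
    exact Icc_subset_Icc ⟨by simpa using h', by simpa using hb⟩ ⟨h', by simpa using hb⟩
  have hcover : ⋃ N, S N = univ := by
    refine eq_univ_of_forall fun p => mem_iUnion.2 ?_
    obtain ⟨N, hN⟩ := exists_nat_ge (max |p.1| |p.2|)
    have h1 := (le_max_left _ _).trans hN
    have h2 := (le_max_right _ _).trans hN
    have hb := abs_le_bracket (N : ℝ)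
    rw [abs_of_nonneg (by positivity)] at hb
    have hb' := bracket_pos ((N : ℝ) : ℂ)
    refine ⟨N, ⟨(abs_le.1 h1).1, ?_⟩, ⟨(abs_le.1 h1).2, ?_⟩⟩
    · have := (abs_le.1 h2).1
      simp only
      linarith
    · have := (abs_le.1 h2).2
      simp only
      linarith
  have hlim := tendsto_setIntegral_of_monotone (μ := volume) (f := fun p => (2 : ℂ) • k p)
    (fun N => (measurableSet_Icc : MeasurableSet (S N))) hmono (hint.smul (2 : ℂ)).integrableOn
  rw [hcover, Measure.restrict_univ] at hlim
  have hbt : Tendsto (fun N : ℕ => bracket ((N : ℝ) : ℂ)) atTop atTop :=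
    tendsto_atTop_mono (fun N => (le_abs_self (N : ℝ)).trans (abs_le_bracket N))
      tendsto_natCast_atTop_atTop
  have hdecay : Tendsto (fun N : ℕ => bracket ((N : ℝ) : ℂ) ^ β) atTop (𝓝 0) := by
    have := (tendsto_rpow_neg_atTop (neg_pos.2 hβ)).comp hbt
    simpa [Function.comp_def] using this
  have hlim0 : Tendsto (fun N => ∫ p in S N, (2 : ℂ) • k p) atTop (𝓝 0) := by
    have h := hdecay.const_mul ((K₁ * 2 ^ (q - α) + C' * |K₂|) * 4)
    rw [mul_zero] at h
    refine squeeze_zero_norm' ?_ h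
    filter_upwards [eventually_ge_atTop 1] with N hN using hS N hN
  have h0 := tendsto_nhds_unique hlim hlim0
  rw [integral_smul] at h0
  exact (smul_eq_zero.1 h0).resolve_left two_ne_zero

end Stokes

/-! ### Independence of the extension -/

section Independence

variable {E : Type*} [NormedAddCommGroup E] [NormedSpace ℂ E]

theorem integrable_dbar_almostAnalytic_smul {f ψ : ℝ → ℂ} {α β c : ℝ} (hα : 0 ≤ α) (hβ : β < 0)
    (hf : f ∈ symbolClass β) (hψ : IsCutoff ψ) {n : ℕ} (hn : α < n) {Φ : ℂ → E}
    (hΦ : ResolventGrowth α c Φ) (hΦc : ∀ z : ℂ, z.im ≠ 0 → ContinuousAt Φ z) :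
    Integrable fun p : ℝ × ℝ =>
      dbar (almostAnalytic n ψ f) p.1 p.2 • Φ (p.1 + p.2 * Complex.I) := by
  obtain ⟨D, hD, hle⟩ := exists_dominating (E := E) hα hβ hf hψ hn
  refine (hD.const_mul c).mono' (aestronglyMeasurable_dbar_smul
    ((contDiff_almostAnalytic hf.1 hψ.smooth n).of_le (by simp)) hΦc) ?_
  filter_upwards [ae_snd_ne_zero] with p hp using hle c Φ hΦ p hp

/-- The shifted functions `z ↦ Φ(z - 1/(k+1))` have integrals converging to that of `Φ`, by
dominated convergence. -/
theorem tendsto_integral_dbar_almostAnalytic_smul {f ψ : ℝ → ℂ} {α β c : ℝ} (hα : 0 ≤ α)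
    (hβ : β < 0) (hf : f ∈ symbolClass β) (hψ : IsCutoff ψ) {n : ℕ} (hn : α < n) {Φ : ℂ → E}
    (hΦ : ResolventGrowth α c Φ) (hΦc : ∀ z : ℂ, z.im ≠ 0 → ContinuousAt Φ z) :
    Tendsto (fun k : ℕ => ∫ p : ℝ × ℝ, dbar (almostAnalytic n ψ f) p.1 p.2 •
        Φ (p.1 + p.2 * Complex.I - (1 / ((k : ℝ) + 1) : ℝ))) atTop
      (𝓝 (∫ p : ℝ × ℝ, dbar (almostAnalytic n ψ f) p.1 p.2 • Φ (p.1 + p.2 * Complex.I))) := by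
  obtain ⟨D, hD, hle⟩ := exists_dominating (E := E) hα hβ hf hψ hn
  have hk : ∀ k : ℕ, ResolventGrowth α (c * 2 ^ α)
      (fun z => Φ (z - (1 / ((k : ℝ) + 1) : ℝ))) := fun k =>
    hΦ.comp_sub hα (by positivity) (by
      rw [div_le_one (by positivity)]
      linarith [(Nat.cast_nonneg k : (0 : ℝ) ≤ k)])
  have hkc : ∀ (k : ℕ) (z : ℂ), z.im ≠ 0 →
      ContinuousAt (fun z => Φ (z - (1 / ((k : ℝ) + 1) : ℝ))) z := fun k z hz =>
    ContinuousAt.comp (f := fun z : ℂ => z - (1 / ((k : ℝ) + 1) : ℝ))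
      (hΦc _ (by rwa [Complex.sub_im, Complex.ofReal_im, sub_zero])) (by fun_prop)
  refine tendsto_integral_of_dominated_convergence (fun p => c * 2 ^ α * D p)
    (fun k => aestronglyMeasurable_dbar_smul (Φ := fun z => Φ (z - (1 / ((k : ℝ) + 1) : ℝ)))
      ((contDiff_almostAnalytic hf.1 hψ.smooth n).of_le (by simp)) (hkc k))
    (hD.const_mul _) (fun k => ?_) ?_
  · filter_upwards [ae_snd_ne_zero] with p hp using hle _ _ (hk k) p hp
  · filter_upwards [ae_snd_ne_zero] with p hp
    refine tendsto_const_nhds.smul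
      ((hΦc (p.1 + p.2 * Complex.I) (by simpa using hp)).tendsto.comp ?_)
    have h1 : Tendsto (fun k : ℕ => ((1 / ((k : ℝ) + 1) : ℝ) : ℂ)) atTop (𝓝 0) := by
      simpa [Function.comp_def] using (Complex.continuous_ofReal.tendsto 0).comp
        (tendsto_one_div_add_atTop_nhds_zero_nat (𝕜 := ℝ))
    simpa using h1.const_sub ((p.1 : ℂ) + p.2 * Complex.I)

/-- The two integrals agree for a function holomorphic off `[δ, ∞)`: the difference of the
extensions is a function to which `integral_dbar_smul_eq_zero` applies. -/
theorem integral_dbar_almostAnalytic_smul_eq_of_pos [CompleteSpace E] {f g ψ χ : ℝ → ℂ}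
    {α β c δ : ℝ} (hα : 0 ≤ α) (hβ : β < 0) (hδ : 0 < δ) (hf : f ∈ symbolClass β)
    (hg : g ∈ symbolClass β) (hfg : EqOn f g (Ici 0)) (hψ : IsCutoff ψ) (hχ : IsCutoff χ)
    {n m : ℕ} (hn : α < n) (hm : α < m) {Φ : ℂ → E} (hΦ : ResolventGrowth α c Φ)
    (hΦd : ∀ z : ℂ, z.im ≠ 0 ∨ z.re < δ → DifferentiableAt ℂ Φ z) :
    ∫ p : ℝ × ℝ, dbar (almostAnalytic n ψ f) p.1 p.2 • Φ (p.1 + p.2 * Complex.I) =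
      ∫ p : ℝ × ℝ, dbar (almostAnalytic m χ g) p.1 p.2 • Φ (p.1 + p.2 * Complex.I) := by
  have hc : ∀ z : ℂ, z.im ≠ 0 → ContinuousAt Φ z := fun z hz => (hΦd z (Or.inl hz)).continuousAt
  have hF : ContDiff ℝ 1 fun p : ℝ × ℝ => almostAnalytic n ψ f p.1 p.2 :=
    (contDiff_almostAnalytic hf.1 hψ.smooth n).of_le (by simp)
  have hG : ContDiff ℝ 1 fun p : ℝ × ℝ => almostAnalytic m χ g p.1 p.2 :=
    (contDiff_almostAnalytic hg.1 hχ.smooth m).of_le (by simp)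
  have hi := integrable_dbar_almostAnalytic_smul hα hβ hf hψ hn hΦ hc
  have hi' := integrable_dbar_almostAnalytic_smul hα hβ hg hχ hm hΦ hc
  obtain ⟨C₁, hC₁, h₁⟩ := exists_norm_almostAnalytic_le hf hψ n
  obtain ⟨C₂, hC₂, h₂⟩ := exists_norm_almostAnalytic_le hg hχ m
  obtain ⟨C, hC, h⟩ := exists_norm_almostAnalytic_sub_le hf hg hfg hψ hχ
    (min_le_left n m) (min_le_right n m)
  have hsub : ∀ p : ℝ × ℝ,
      dbar (fun x y => almostAnalytic n ψ f x y - almostAnalytic m χ g x y) p.1 p.2 •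
        Φ (p.1 + p.2 * Complex.I) =
      dbar (almostAnalytic n ψ f) p.1 p.2 • Φ (p.1 + p.2 * Complex.I) -
        dbar (almostAnalytic m χ g) p.1 p.2 • Φ (p.1 + p.2 * Complex.I) := fun p => by
    rw [dbar_sub hF hG, sub_smul]
  rw [← sub_eq_zero, ← integral_sub hi hi', ← integral_congr_ae (Eventually.of_forall hsub)]
  refine integral_dbar_smul_eq_zero (q := ((min n m : ℕ) : ℝ)) hα hβ hδ (hF.sub hG) hΦ hΦd ?_ hC
    (add_nonneg hC₁ hC₂) (fun x y hxy => ?_) (fun x y => ?_) (fun x y hx => ?_)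
    ((hi.sub hi').congr (Eventually.of_forall fun p => (hsub p).symm))
  · rw [Nat.cast_min]
    exact lt_min hn hm
  · rw [almostAnalytic_eq_zero hψ n f hxy, almostAnalytic_eq_zero hχ m g hxy, sub_zero]
  · rw [add_mul]
    exact (norm_sub_le _ _).trans (add_le_add (h₁ x y) (h₂ x y))
  · exact_mod_cast h x y hx

/-- The Helffer–Sjöstrand integral against a function holomorphic off `[0, ∞)` only depends on the
restriction of `f` to `[0, ∞)`. -/
theorem integral_dbar_almostAnalytic_smul_eq [CompleteSpace E] {f g ψ χ : ℝ → ℂ} {α β c : ℝ}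
    (hα : 0 ≤ α) (hβ : β < 0) (hf : f ∈ symbolClass β) (hg : g ∈ symbolClass β)
    (hfg : EqOn f g (Ici 0)) (hψ : IsCutoff ψ) (hχ : IsCutoff χ) {n m : ℕ} (hn : α < n)
    (hm : α < m) {Φ : ℂ → E} (hΦ : ResolventGrowth α c Φ)
    (hΦd : ∀ z : ℂ, z.im ≠ 0 ∨ z.re < 0 → DifferentiableAt ℂ Φ z) :
    ∫ p : ℝ × ℝ, dbar (almostAnalytic n ψ f) p.1 p.2 • Φ (p.1 + p.2 * Complex.I) =
      ∫ p : ℝ × ℝ, dbar (almostAnalytic m χ g) p.1 p.2 • Φ (p.1 + p.2 * Complex.I) := by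
  have hc : ∀ z : ℂ, z.im ≠ 0 → ContinuousAt Φ z := fun z hz => (hΦd z (Or.inl hz)).continuousAt
  refine tendsto_nhds_unique_of_eventuallyEq
    (tendsto_integral_dbar_almostAnalytic_smul hα hβ hf hψ hn hΦ hc)
    (tendsto_integral_dbar_almostAnalytic_smul hα hβ hg hχ hm hΦ hc)
    (Eventually.of_forall fun k => ?_)
  have hδ : 0 < 1 / ((k : ℝ) + 1) := by positivity
  have hδ1 : 1 / ((k : ℝ) + 1) ≤ 1 := by
    rw [div_le_one (by positivity)]
    linarith [(Nat.cast_nonneg k : (0 : ℝ) ≤ k)]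
  refine integral_dbar_almostAnalytic_smul_eq_of_pos
    (Φ := fun z => Φ (z - (1 / ((k : ℝ) + 1) : ℝ))) hα hβ hδ hf hg hfg hψ hχ hn hm
    (hΦ.comp_sub hα hδ.le hδ1) fun z hz => ?_
  refine DifferentiableAt.comp (g := Φ) (f := fun z : ℂ => z - (1 / ((k : ℝ) + 1) : ℝ)) z
    (hΦd _ ?_) (by fun_prop)
  rwa [Complex.sub_im, Complex.ofReal_im, sub_zero, Complex.sub_re, Complex.ofReal_re, sub_neg]

end Independence

theorem mem_nhds_resolventSet {B : Type*} [NormedAddCommGroup B] [NormedSpace ℂ B]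
    {H : B →ₗ.[ℂ] B} (hspec : spectrum H ⊆ (fun t : ℝ => (t : ℂ)) '' Ici 0) {z : ℂ}
    (hz : z.im ≠ 0 ∨ z.re < 0) : resolventSet H ∈ 𝓝 z := by
  have hopen : IsOpen {w : ℂ | w.im ≠ 0 ∨ w.re < 0} :=
    (isOpen_ne_fun Complex.continuous_im continuous_const).union
      (isOpen_lt Complex.continuous_re continuous_const)
  refine mem_of_superset (hopen.mem_nhds hz) fun w hw => ?_
  by_contra h
  obtain ⟨t, ht, rfl⟩ := hspec h
  rcases hw with hw | hw
  · exact hw (Complex.ofReal_im t)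
  · exact absurd hw (not_lt.2 ht)

end HelfferSjostrand

theorem mainTheorem2 {B : Type*} [NormedAddCommGroup B] [NormedSpace ℂ B] [CompleteSpace B]
    (H : B →ₗ.[ℂ] B) (hclosed : H.IsClosed) (hdense : Dense (H.domain : Set B))
    (hspec : HelfferSjostrand.spectrum H ⊆ (fun t : ℝ => (t : ℂ)) '' Set.Ici 0)
    (α c : ℝ) (hα : 0 ≤ α)
    (hres : ∀ z : ℂ, z.im ≠ 0 →
      ‖HelfferSjostrand.resolvent H z‖ ≤
        c * |z.im|⁻¹ * (HelfferSjostrand.bracket z / |z.im|) ^ α)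
    (f g : ℝ → ℂ) (hf : f ∈ HelfferSjostrand.slowAlgebra)
    (hg : g ∈ HelfferSjostrand.slowAlgebra) (hfg : Set.EqOn f g (Set.Ici 0))
    (n m : ℕ) (hn : α < n) (hm : α < m)
    (ψ χ : ℝ → ℂ) (hψ : HelfferSjostrand.IsCutoff ψ) (hχ : HelfferSjostrand.IsCutoff χ) :
    MeasureTheory.Integrable (HelfferSjostrand.hsIntegrand H n ψ f) ∧
      MeasureTheory.Integrable (HelfferSjostrand.hsIntegrand H m χ g) ∧
      HelfferSjostrand.hsOperator H n ψ f = HelfferSjostrand.hsOperator H m χ g := by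
  obtain ⟨β₁, hβ₁, hf₁⟩ := hf
  obtain ⟨β₂, hβ₂, hg₂⟩ := hg
  have hβ : max β₁ β₂ < 0 := max_lt hβ₁ hβ₂
  have hf' := HelfferSjostrand.symbolClass_mono (le_max_left β₁ β₂) hf₁
  have hg' := HelfferSjostrand.symbolClass_mono (le_max_right β₁ β₂) hg₂
  have hd : ∀ z : ℂ, z.im ≠ 0 ∨ z.re < 0 →
      DifferentiableAt ℂ (HelfferSjostrand.resolvent H) z := fun z hz =>
    HelfferSjostrand.differentiableAt_resolvent (HelfferSjostrand.mem_nhds_resolventSet hspec hz)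
  have hc : ∀ z : ℂ, z.im ≠ 0 → ContinuousAt (HelfferSjostrand.resolvent H) z := fun z hz =>
    (hd z (Or.inl hz)).continuousAt
  refine ⟨HelfferSjostrand.integrable_dbar_almostAnalytic_smul hα hβ hf' hψ hn hres hc,
    HelfferSjostrand.integrable_dbar_almostAnalytic_smul hα hβ hg' hχ hm hres hc, ?_⟩
  exact congrArg (fun T : B →L[ℂ] B => (-(1 / (Real.pi : ℂ))) • T)
    (HelfferSjostrand.integral_dbar_almostAnalytic_smul_eq hα hβ hf' hg' hfg hψ hχ hn hm hres hd)
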